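/- Let $M\ge 0$, let $I\subset\mathbb{R}$ and $J_m\subset\mathbb{R}^{N_m}$ $(1\le m\le M)$, and put $\mathbf{J}=\prod_m J_m$. Let $H$ be a random variable with values in $I$ and arbitrary law $\mathbf{d}_H$, and let $A_1,\dots,A_M$ be random variables with values in $J_1,\dots,J_M$ that are conditionally independent given $H$. Assume that $A_m$ given $H=h$ has a density $\mathbf{d}_{A_m|H}(\cdot,h)$ with respect to a $\sigma$-finite measure $\nu_m$ on $J_m$ (for instance Lebesgue measure, or counting measure on a discrete set), where $\mathbf{d}_{A_m|H}$ is continuous, bounded and strictly positive on $J_m\times I$. Write $\mathbf{A}=(A_1,\dots,A_M)$ and, for $\mathbf{a}\in\mathbf{J}$ and a function $\varphi$, $$E(\varphi(H)\mid\mathbf{A}=\mathbf{a})=\frac{\int_I\varphi(h)\prod_{m}\mathbf{d}_{A_m|H}(a_m,h)\,\mathbf{d}_H(dh)}{\int_I\prod_{m}\mathbf{d}_{A_m|H}(a_m,h)\,\mathbf{d}_H(dh)} .$$ Suppose that $H$ is sub-Gaussian, i.e. $E(e^{rH^2})<\infty$ for some $r>0$, and that for each $\mathbf{a}\in\mathbf{J}$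 the zeros of the function $z\mapsto E(e^{-2\pi izH}\mid\mathbf{A}=\mathbf{a})$, $z\in\mathbb{C}$, are symmetric under $z\mapsto -z$, counted with multiplicity: whenever $z$ is a zero, $-z$ is a zero of the same multiplicity. Let $K\subset\mathbb{R}$ be an interval (possibly unbounded) with $I\subset K$. Let $W:\mathbb{R}\to\mathbb{R}$ be the restriction of an entire function, even, nonnegative and convex, with $$\alpha_1(|x|^p-1)\le |W(x)|\le\alpha_2(|x|^p+1)\qquad(x\in\mathbb{R})$$ for some constants $\alpha_1,\alpha_2>0$ and $p\ge1$. Then the posterior mean rule $f(\mathbf{a})=E(H\mid\mathbf{A}=\mathbf{a})$ is Bayes optimal among deterministic rules for the cost $W(c-h)$: $f$ is a measurable map $\mathbf{J}\to K$, its risk $E(W(f(\mathbf{A})-H))$ is finite, and $E(W(f(\mathbf{A})-H))\le E(W(g(\mathbf{A})-H))$ for every measurable $g:\mathbf{J}\to K$. -/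

import Mathlib

open MeasureTheory

noncomputable section

/-- The data of a fusion problem with `M` sensors: an object space `I ⊆ ℝ`, feature spaces
`J m ⊆ ℝ ^ (N m)`, the prior law of the object `H` (an arbitrary probability measure on `I`, so that
discrete priors are allowed), and the conditional densities `dens m a h` of the `m`-th sensor output
given `H = h`, which are positive, bounded and jointly continuous.  Densities are taken with respect
to a σ-finite reference measure `ref m` on `J m`: Lebesgue measure for continuous features, counting
measure for discrete ones. -/
structure FusionProblem (M : ℕ) (N : Fin M → ℕ) (I : Set ℝ)
    (J : (m : Fin M) → Set (EuclideanSpace ℝ (Fin (N m)))) where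
  prior : Measure I
  prior_prob : IsProbabilityMeasure prior
  ref : (m : Fin M) → Measure (J m)
  ref_sigmaFinite : ∀ m, SigmaFinite (ref m)
  dens : (m : Fin M) → J m → I → ℝ
  dens_continuous : ∀ m, Continuous fun x : J m × I => dens m x.1 x.2
  dens_bounded : ∀ m, ∃ B : ℝ, ∀ a h, dens m a h ≤ B
  dens_pos : ∀ m a h, 0 < dens m a h
  dens_normalized : ∀ m h, ∫⁻ a, ENNReal.ofReal (dens m a h) ∂(ref m) = 1

namespace FusionProblem

variable {M : ℕ} {N : Fin M → ℕ} {I : Set ℝ}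
  {J : (m : Fin M) → Set (EuclideanSpace ℝ (Fin (N m)))}

/-- The conditional density of `A = (A_1, …, A_M)` given `H = h`; the sensors are conditionally
independent given `H`. -/
def likelihood (P : FusionProblem M N I J) (a : (m : Fin M) → J m) (h : I) : ℝ :=
  ∏ m, P.dens m (a m) h

/-- The joint law of `(H, A)`. -/
def jointLaw (P : FusionProblem M N I J) : Measure (I × ((m : Fin M) → J m)) :=
  (P.prior.prod (Measure.pi P.ref)).withDensity
    fun x => ENNReal.ofReal (P.likelihood x.2 x.1)

/-- The posterior expectation `E(φ(H) | A = a)`, by Bayes' formula. -/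
def postExp {E : Type} [NormedAddCommGroup E] [NormedSpace ℝ E] (P : FusionProblem M N I J)
    (φ : ℝ → E) (a : (m : Fin M) → J m) : E :=
  (∫ h, P.likelihood a h ∂P.prior)⁻¹ • ∫ h : I, P.likelihood a h • φ h ∂P.prior

/-- The posterior mean fusion rule `f(a) = E(H | A = a)`. -/
def posteriorMean (P : FusionProblem M N I J) (a : (m : Fin M) → J m) : ℝ :=
  P.postExp (fun h => h) a

/-- The posterior characteristic function `z ↦ E(exp(-2πizH) | A = a)` of a complex variable. -/
def postChar (P : FusionProblem M N I J) (a : (m : Fin M) → J m) (z : ℂ) : ℂ :=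
  P.postExp (fun h => Complex.exp (-2 * Real.pi * Complex.I * z * (h : ℂ))) a

/-- `H` is sub-Gaussian: `E(exp(r H ^ 2)) < ∞` for some `r > 0`. -/
def SubGaussian (P : FusionProblem M N I J) : Prop :=
  ∃ r : ℝ, 0 < r ∧ Integrable (fun h : I => Real.exp (r * (h : ℝ) ^ 2)) P.prior

/-- For every `a`, the zeros of the posterior characteristic function, counted with multiplicity,
are symmetric under `z ↦ -z`. -/
def SymmetricZeros (P : FusionProblem M N I J) : Prop :=
  ∀ (a : (m : Fin M) → J m) (z : ℂ), P.postChar a z = 0 →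
    P.postChar a (-z) = 0 ∧
      analyticOrderAt (P.postChar a) (-z) = analyticOrderAt (P.postChar a) z

/-- The Bayes risk `E(cost(g(A), H))` of the deterministic rule `g`, as an element of `[0, ∞]`, for
a nonnegative cost. -/
def bayesRisk (P : FusionProblem M N I J) (cost : ℝ → ℝ → ℝ) (g : ((m : Fin M) → J m) → ℝ) :
    ENNReal :=
  ∫⁻ x, ENNReal.ofReal (cost (g x.2) x.1) ∂P.jointLaw

/-- A deterministic fusion rule with decision space `K`: a measurable map from the joint feature
space to `K`. -/
def IsFusionRule (K : Set ℝ) (g : ((m : Fin M) → J m) → ℝ) : Prop :=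
  Measurable g ∧ ∀ a, g a ∈ K

/-- `f` is Bayes optimal: it is a deterministic fusion rule with values in `K`, its risk is finite,
and no deterministic fusion rule with values in `K` has smaller risk. -/
def IsBayesOptimal (P : FusionProblem M N I J) (K : Set ℝ) (cost : ℝ → ℝ → ℝ)
    (f : ((m : Fin M) → J m) → ℝ) : Prop :=
  IsFusionRule K f ∧ P.bayesRisk cost f < ⊤ ∧
    ∀ g : ((m : Fin M) → J m) → ℝ, IsFusionRule K g → P.bayesRisk cost f ≤ P.bayesRisk cost g

end FusionProblem

/-- `W : ℝ → ℝ` is the restriction to the real line of an entire function. -/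
def IsEntireOnReal (W : ℝ → ℝ) : Prop :=
  ∃ F : ℂ → ℂ, Differentiable ℂ F ∧ ∀ x : ℝ, F x = W x

end

/-!
Fix `a` and let `f z = E(exp(zH) | A = a)`. Sub-Gaussianity makes `f` entire with
`‖f z‖ ≤ C * exp(B * ‖z‖ ^ 2)`. The symmetry of its zeros makes `f z / f (-z)` an entire function
without zeros, hence of the form `exp(g z)`. The Nevanlinna characteristic of this quotient is
`O(R ^ 2)` by the first fundamental theorem, so the mean of `|Re g|` over the circle of radius `R`
is `O(R ^ 2)` as well, and Cauchy's formula leaves only a polynomial `g` of degree at most two. As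
the quotient is inverted by `z ↦ -z`, `g` has no quadratic term and its constant term is a period of
`exp`; comparing derivatives at `0` gives `f z = exp(2mz) * f (-z)` with `m` the posterior mean:
the posterior law is symmetric about its mean.

For a law symmetric about `m` and an even convex `W`, averaging `W (c - h)` with its reflection and
using convexity shows that the expected cost is smallest at `c = m`. Integrating over `a` compares
the Bayes risks.
-/

section EntireFunctions

open Filter Topology Metric Real ValueDistribution ComplexConjugate

/-! ### Growth and the Nevanlinna characteristic -/

theorem meromorphic_of_differentiable {f : ℂ → ℂ} (hf : Differentiable ℂ f) : Meromorphic f :=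
  fun z => (hf.analyticAt z).meromorphicAt

theorem characteristic_top_isBigO_pow {f : ℂ → ℂ} (hf : Differentiable ℂ f) {C B : ℝ} {n : ℕ}
    (hbound : ∀ z, ‖f z‖ ≤ C * exp (B * ‖z‖ ^ n)) :
    characteristic f ⊤ =O[atTop] fun R => R ^ n := by
  have hposLog (z : ℂ) : log⁺ ‖f z‖ ≤ log⁺ C + |B| * ‖z‖ ^ n := by
    calc log⁺ ‖f z‖ ≤ log⁺ (C * exp (B * ‖z‖ ^ n)) := posLog_le_posLog (norm_nonneg _) (hbound z)
      _ ≤ log⁺ C + log⁺ (exp (B * ‖z‖ ^ n)) := posLog_mul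
      _ ≤ log⁺ C + |B| * ‖z‖ ^ n := by
        gcongr
        simpa [posLog_apply] using
          ⟨by positivity, mul_le_mul_of_nonneg_right (le_abs_self B) (by positivity)⟩
  have hlogCounting : logCounting f ⊤ = 0 := by
    have hdiv : (MeromorphicOn.divisor f Set.univ)⁻ = 0 :=
      negPart_eq_zero.2 (MeromorphicOn.AnalyticOnNhd.divisor_nonneg fun z _ => hf.analyticAt z)
    rw [logCounting_top, hdiv, map_zero]
  refine Asymptotics.IsBigO.of_bound (log⁺ C + |B|) ?_
  filter_upwards [eventually_ge_atTop 1] with R hR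
  rw [norm_of_nonneg (characteristic_nonneg hR), norm_of_nonneg (by positivity)]
  calc characteristic f ⊤ R = circleAverage (fun z => log⁺ ‖f z‖) 0 R := by
        simp [characteristic, hlogCounting, proximity_top]
    _ ≤ log⁺ C + |B| * R ^ n := by
        refine circleAverage_mono_on_of_le_circle
          (meromorphic_of_differentiable hf).meromorphicOn.circleIntegrable_posLog_norm
          fun z hz => ?_
        have hzR : ‖z‖ = R := by simpa [abs_of_nonneg (zero_le_one.trans hR)] using hz
        exact hzR ▸ hposLog z
    _ ≤ log⁺ C * R ^ n + |B| * R ^ n := by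
        gcongr
        exact le_mul_of_one_le_right posLog_nonneg (one_le_pow₀ hR)
    _ = (log⁺ C + |B|) * R ^ n := by ring

theorem circleAverage_abs_log_norm_le {f : ℂ → ℂ} (hf : Meromorphic f) {R : ℝ} (hR : 1 ≤ R) :
    circleAverage (fun z => |log ‖f z‖|) 0 R ≤ characteristic f ⊤ R + characteristic f⁻¹ ⊤ R := by
  have hsplit : (fun z => |log ‖f z‖|) = fun z => log⁺ ‖f z‖ + log⁺ ‖f⁻¹ z‖ := by
    ext z
    have hlog := posLog_sub_posLog_inv (x := ‖f z‖)
    have habs := half_mul_log_add_log_abs (x := ‖f z‖)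
    simp only [Pi.inv_apply, norm_inv]
    linarith
  rw [hsplit, circleAverage_fun_add hf.meromorphicOn.circleIntegrable_posLog_norm
    hf.inv.meromorphicOn.circleIntegrable_posLog_norm]
  simp only [characteristic, Pi.add_apply, proximity_top]
  have h₁ := logCounting_nonneg (f := f) (e := ⊤) hR
  have h₂ := logCounting_nonneg (f := f⁻¹) (e := ⊤) hR
  linarith

theorem characteristic_inv_top_isBigO {f : ℂ → ℂ} (hf : Meromorphic f) {n : ℕ}
    (hgrowth : characteristic f ⊤ =O[atTop] fun R => R ^ n) :
    characteristic f⁻¹ ⊤ =O[atTop] fun R => R ^ n := by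
  have hone : (1 : ℝ → ℝ) =O[atTop] fun R : ℝ => R ^ n := by
    refine Asymptotics.IsBigO.of_bound 1 ?_
    filter_upwards [eventually_ge_atTop 1] with R hR
    simpa [abs_of_nonneg (zero_le_one.trans hR)] using one_le_pow₀ hR
  simpa using hgrowth.sub ((isBigO_characteristic_sub_characteristic_inv hf).trans hone)

theorem circleAverage_abs_log_norm_isBigO {f : ℂ → ℂ} (hf : Meromorphic f) {n : ℕ}
    (hgrowth : characteristic f ⊤ =O[atTop] fun R => R ^ n) :
    (fun R => circleAverage (fun z => |log ‖f z‖|) 0 R) =O[atTop] fun R => R ^ n := by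
  refine .trans (.of_bound' ?_) (hgrowth.add (characteristic_inv_top_isBigO hf hgrowth))
  filter_upwards [eventually_ge_atTop 1] with R hR
  rw [norm_of_nonneg (circleAverage_nonneg_of_nonneg fun z _ => abs_nonneg _)]
  exact (circleAverage_abs_log_norm_le hf hR).trans (le_norm_self _)

theorem characteristic_mul_inv_top_isBigO {f h : ℂ → ℂ} (hf : Meromorphic f) (hh : Meromorphic h)
    (hf_order : ∀ z, meromorphicOrderAt f z ≠ ⊤) (hh_order : ∀ z, meromorphicOrderAt h z ≠ ⊤)
    {n : ℕ} (hf_growth : characteristic f ⊤ =O[atTop] fun R => R ^ n)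
    (hh_growth : characteristic h ⊤ =O[atTop] fun R => R ^ n) :
    characteristic (f * h⁻¹) ⊤ =O[atTop] fun R => R ^ n := by
  refine .trans (.of_bound' ?_) (hf_growth.add (characteristic_inv_top_isBigO hh hh_growth))
  filter_upwards [eventually_ge_atTop 1] with R hR
  rw [norm_of_nonneg (characteristic_nonneg hR)]
  refine (characteristic_mul_top_le hR hf hf_order hh.inv fun z => ?_).trans (le_norm_self _)
  simpa [meromorphicOrderAt_inv] using hh_order z

theorem analyticOrderAt_ne_top_of_ne_zero {f : ℂ → ℂ} (hf : Differentiable ℂ f) (hf₀ : f ≠ 0)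
    (z : ℂ) : analyticOrderAt f z ≠ ⊤ := by
  intro htop
  have hfa : AnalyticOnNhd ℂ f Set.univ := fun w _ => hf.analyticAt w
  exact hf₀ (hfa.eq_of_eventuallyEq (g := 0) analyticOnNhd_const (analyticOrderAt_eq_top.1 htop))

theorem characteristic_isBigO_of_eq_mul {f h q : ℂ → ℂ} (hf : Differentiable ℂ f)
    (hh : Differentiable ℂ h) (hf₀ : f ≠ 0) (hfq : f = q * h) {n : ℕ}
    (hf_growth : characteristic f ⊤ =O[atTop] fun R => R ^ n)
    (hh_growth : characteristic h ⊤ =O[atTop] fun R => R ^ n) :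
    characteristic q ⊤ =O[atTop] fun R => R ^ n := by
  have hh₀ : h ≠ 0 := by
    rintro rfl
    exact hf₀ (by simp [hfq])
  obtain ⟨z₀, hz₀⟩ := Function.ne_iff.1 hh₀
  have horder {k : ℂ → ℂ} (hk : Differentiable ℂ k) (hk₀ : k ≠ 0) (z : ℂ) :
      meromorphicOrderAt k z ≠ ⊤ := by
    simpa [(hk.analyticAt z).meromorphicOrderAt_eq] using analyticOrderAt_ne_top_of_ne_zero hk hk₀ z
  have hq : q =ᶠ[codiscrete ℂ] f * h⁻¹ := by
    filter_upwards [AnalyticOnNhd.preimage_zero_mem_codiscrete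
      (fun z _ => hh.analyticAt z) hz₀] with z hz
    simp [hfq, mul_inv_cancel_right₀ (by simpa using hz : h z ≠ 0)]
  refine (characteristic_mul_inv_top_isBigO (meromorphic_of_differentiable hf)
    (meromorphic_of_differentiable hh) (horder hf hf₀) (horder hh hh₀) hf_growth
    hh_growth).congr' ?_ .rfl
  filter_upwards [eventually_ne_atTop 0] with R hR
  exact (characteristic_congr_codiscrete hq hR).symm

/-! ### Entire functions with real part of polynomial growth -/

theorem circleIntegrable_mul_inv_pow {g : ℂ → ℂ} (hg : Continuous g) (k : ℕ) {R : ℝ}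
    (hR : R ≠ 0) : CircleIntegrable (fun z => g z * (z ^ k)⁻¹) 0 R := by
  refine ContinuousOn.circleIntegrable' <| hg.continuousOn.mul <|
    (continuousOn_id.pow k).inv₀ fun z hz => pow_ne_zero k ?_
  exact ne_of_mem_sphere hz (abs_pos.2 hR).ne'

theorem circleAverage_mul_inv_pow {g : ℂ → ℂ} (hg : Differentiable ℂ g) (k : ℕ)
    {R : ℝ} (hR : 0 < R) :
    circleAverage (fun z => g z * (z ^ k)⁻¹) 0 R = (k.factorial : ℂ)⁻¹ * iteratedDeriv k g 0 := by
  have hintegrand (z : ℂ) :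
      (z - 0)⁻¹ • (g z * (z ^ k)⁻¹) = (1 / (z - 0) ^ (k + 1)) • g z := by
    simp only [sub_zero, smul_eq_mul, one_div, pow_succ, mul_inv]
    ring
  rw [circleAverage_eq_circleIntegral hR.ne']
  simp_rw [hintegrand]
  rw [(hg.diffContOnCl (s := ball 0 R)).circleIntegral_one_div_sub_center_pow_smul hR k,
    smul_eq_mul, smul_eq_mul]
  field_simp [Complex.two_pi_I_ne_zero]

theorem circleAverage_conj_mul_inv_pow {g : ℂ → ℂ} (hg : Differentiable ℂ g) {k : ℕ} (hk : k ≠ 0)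
    {R : ℝ} (hR : 0 < R) :
    circleAverage (fun z => conj (g z) * (z ^ k)⁻¹) 0 R = 0 := by
  -- On the circle `conj z = R ^ 2 / z`, so the integrand is the conjugate of an entire function.
  set G : ℂ → ℂ := fun z => ((R : ℂ) ^ (2 * k))⁻¹ * (g z * z ^ k) with hG
  have hGd : Differentiable ℂ G := by fun_prop
  have hGavg : circleAverage G 0 R = 0 := by
    rw [(hGd.diffContOnCl (s := ball 0 |R|)).circleAverage]
    simp [hG, hk]
  have hconj : circleAverage (conj ∘ G) 0 R = 0 :=
    ((Complex.conjCLE : ℂ →L[ℝ] ℂ).circleAverage_comp_comm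
      hGd.continuous.continuousOn.circleIntegrable').trans (by rw [hGavg, map_zero])
  refine (circleAverage_congr_sphere fun z hz => ?_).trans hconj
  have hz₀ : z ≠ 0 := ne_of_mem_sphere hz (abs_pos.2 hR.ne').ne'
  have hzR : (R : ℂ) ^ 2 = z * conj z := by
    have hnorm : ‖z‖ = R := by simpa [abs_of_pos hR] using hz
    rw [Complex.mul_conj', hnorm]
  have hzc : conj z ≠ 0 := by simpa using hz₀
  simp only [hG, Function.comp, map_mul, map_inv₀, map_pow, pow_mul, hzR, Complex.conj_conj]
  field_simp
  ring

theorem circleAverage_re_mul_inv_pow {g : ℂ → ℂ} (hg : Differentiable ℂ g) {k : ℕ} (hk : k ≠ 0)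
    {R : ℝ} (hR : 0 < R) :
    circleAverage (fun z => 2 * ((g z).re : ℂ) * (z ^ k)⁻¹) 0 R =
      (k.factorial : ℂ)⁻¹ * iteratedDeriv k g 0 := by
  have hsplit (z : ℂ) : 2 * ((g z).re : ℂ) * (z ^ k)⁻¹ =
      g z * (z ^ k)⁻¹ + conj (g z) * (z ^ k)⁻¹ := by
    rw [← add_mul, Complex.add_conj]
    push_cast
    ring
  simp_rw [hsplit]
  have hconj : Continuous fun z => conj (g z) := Complex.continuous_conj.comp hg.continuous
  rw [circleAverage_fun_add (circleIntegrable_mul_inv_pow hg.continuous k hR.ne')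
    (circleIntegrable_mul_inv_pow hconj k hR.ne'),
    circleAverage_mul_inv_pow hg k hR, circleAverage_conj_mul_inv_pow hg hk hR, add_zero]

theorem norm_circleAverage_le {E : Type*} [NormedAddCommGroup E] [NormedSpace ℝ E] {f : ℂ → E}
    {c : ℂ} {R : ℝ} : ‖circleAverage f c R‖ ≤ circleAverage (fun z => ‖f z‖) c R := by
  rw [circleAverage_def, circleAverage_def, norm_smul, norm_of_nonneg (by positivity), smul_eq_mul]
  gcongr
  exact intervalIntegral.norm_integral_le_integral_norm two_pi_pos.le

theorem norm_iteratedDeriv_le_circleAverage_abs_re {g : ℂ → ℂ} (hg : Differentiable ℂ g) {k : ℕ}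
    (hk : k ≠ 0) {R : ℝ} (hR : 0 < R) :
    ‖(k.factorial : ℂ)⁻¹ * iteratedDeriv k g 0‖ ≤
      2 * (R ^ k)⁻¹ * circleAverage (fun z => |(g z).re|) 0 R := by
  rw [← circleAverage_re_mul_inv_pow hg hk hR, ← smul_eq_mul, ← circleAverage_fun_smul]
  refine norm_circleAverage_le.trans_eq (circleAverage_congr_sphere fun z hz => ?_)
  have hzR : ‖z‖ = R := by simpa [abs_of_pos hR] using hz
  simp only [norm_mul, Complex.norm_two, Complex.norm_real, norm_inv, norm_pow, hzR, norm_eq_abs,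
    smul_eq_mul]
  ring

theorem iteratedDeriv_eq_zero_of_circleAverage_abs_re_isBigO {g : ℂ → ℂ} (hg : Differentiable ℂ g)
    {n : ℕ} (hgrowth : (fun R => circleAverage (fun z => |(g z).re|) 0 R) =O[atTop] fun R => R ^ n)
    {k : ℕ} (hk : n < k) : iteratedDeriv k g 0 = 0 := by
  have hbound : (fun _ : ℝ => (k.factorial : ℂ)⁻¹ * iteratedDeriv k g 0) =O[atTop]
      fun R : ℝ => (R ^ k)⁻¹ * R ^ n := by
    refine .trans (.of_bound 2 ?_) ((Asymptotics.isBigO_refl _ atTop).mul hgrowth)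
    filter_upwards [eventually_gt_atTop 0] with R hR
    rw [norm_of_nonneg (mul_nonneg (by positivity)
      (circleAverage_nonneg_of_nonneg fun z _ => abs_nonneg _)), ← mul_assoc]
    exact norm_iteratedDeriv_le_circleAverage_abs_re hg (by omega) hR
  have hlim : Tendsto (fun R : ℝ => (R ^ k)⁻¹ * R ^ n) atTop (𝓝 0) := by
    simpa [div_eq_inv_mul] using tendsto_pow_div_pow_atTop_zero (𝕜 := ℝ) hk
  have hzero := tendsto_nhds_unique tendsto_const_nhds (hbound.trans_tendsto hlim)
  simpa [Nat.factorial_ne_zero] using hzero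

theorem exists_polynomial_of_circleAverage_abs_re_isBigO {g : ℂ → ℂ} (hg : Differentiable ℂ g)
    {n : ℕ}
    (hgrowth : (fun R => circleAverage (fun z => |(g z).re|) 0 R) =O[atTop] fun R => R ^ n) :
    ∃ p : Polynomial ℂ, p.natDegree ≤ n ∧ ∀ z, g z = p.eval z := by
  refine ⟨∑ k ∈ Finset.range (n + 1),
    Polynomial.C ((k.factorial : ℂ)⁻¹ * iteratedDeriv k g 0) * Polynomial.X ^ k,
    Polynomial.natDegree_sum_le_of_forall_le _ _ fun k hk =>
      (Polynomial.natDegree_C_mul_X_pow_le _ _).trans (by simpa [Nat.lt_succ_iff] using hk),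
    fun z => ?_⟩
  rw [← Complex.taylorSeries_eq_of_entire' 0 z hg, tsum_eq_sum (s := Finset.range (n + 1))]
  · simp [Polynomial.eval_finsetSum]
  · intro k hk
    rw [iteratedDeriv_eq_zero_of_circleAverage_abs_re_isBigO hg hgrowth (by simpa using hk)]
    simp

/-! ### Zero-free quotients -/

theorem exists_differentiable_quotient {f h : ℂ → ℂ} (hf : Differentiable ℂ f)
    (hh : Differentiable ℂ h) (hh₀ : h ≠ 0)
    (horder : ∀ z, analyticOrderAt f z = analyticOrderAt h z) :
    ∃ q : ℂ → ℂ, Differentiable ℂ q ∧ (∀ z, q z ≠ 0) ∧ f = q * h := by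
  have hfm := meromorphic_of_differentiable hf
  have hhm := meromorphic_of_differentiable hh
  have hdiv : MeromorphicOn (f / h) Set.univ := fun z _ => (hfm z).div (hhm z)
  set q := toMeromorphicNFOn (f / h) Set.univ
  have hqNF (z : ℂ) : MeromorphicNFAt q z :=
    meromorphicNFOn_toMeromorphicNFOn (f / h) Set.univ (Set.mem_univ z)
  have hq_eq (z : ℂ) : q =ᶠ[𝓝[≠] z] f / h :=
    hdiv.toMeromorphicNFOn_eq_self_on_nhdsNE (Set.mem_univ z)
  have hq_order (z : ℂ) : meromorphicOrderAt q z = 0 := by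
    rw [meromorphicOrderAt_congr (hq_eq z), meromorphicOrderAt_div (hfm z) (hhm z),
      (hf.analyticAt z).meromorphicOrderAt_eq, (hh.analyticAt z).meromorphicOrderAt_eq, horder z]
    lift analyticOrderAt h z to ℕ using analyticOrderAt_ne_top_of_ne_zero hh hh₀ z with n
    simp [sub_eq_add_neg]
  have hqa (z : ℂ) : AnalyticAt ℂ q z :=
    (hqNF z).meromorphicOrderAt_nonneg_iff_analyticAt.1 (hq_order z).ge
  refine ⟨q, fun z => (hqa z).differentiableAt,
    fun z => (hqNF z).meromorphicOrderAt_eq_zero_iff.1 (hq_order z), funext fun z => ?_⟩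
  have hh_ne : ∀ᶠ w in 𝓝[≠] z, h w ≠ 0 :=
    (hh.analyticAt z).eventually_eq_zero_or_eventually_ne_zero.resolve_left fun hzero =>
      analyticOrderAt_ne_top_of_ne_zero hh hh₀ z (analyticOrderAt_eq_top.2 hzero)
  have hf_eq : f =ᶠ[𝓝[≠] z] q * h := by
    filter_upwards [hq_eq z, hh_ne] with w hw hhw
    simp [hw, hhw]
  exact (((hf.analyticAt z).frequently_eq_iff_eventually_eq ((hqa z).mul (hh.analyticAt z))).1
    hf_eq.frequently).self_of_nhds

theorem exists_differentiable_log {q : ℂ → ℂ} (hq : Differentiable ℂ q) (hq₀ : ∀ z, q z ≠ 0) :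
    ∃ g : ℂ → ℂ, Differentiable ℂ g ∧ ∀ z, q z = Complex.exp (g z) := by
  have hlogDeriv : Differentiable ℂ (logDeriv q) :=
    (hq.contDiff (n := 2)).differentiable_deriv_two.div hq hq₀
  obtain ⟨g, hg₀, hg⟩ := hlogDeriv.isExactOn_univ.with_val_at 0 (Complex.log (q 0))
  replace hg (z : ℂ) : HasDerivAt g (logDeriv q z) z := hg z (Set.mem_univ z)
  have hderiv (z : ℂ) : HasDerivAt (fun z => q z * Complex.exp (-g z)) 0 z := by
    refine ((hq z).hasDerivAt.mul (hg z).fun_neg.cexp).congr_deriv ?_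
    rw [logDeriv_apply]
    field_simp [hq₀ z]
    ring
  refine ⟨g, fun z => (hg z).differentiableAt, fun z => ?_⟩
  have hconst : q z * Complex.exp (-g z) = q 0 * Complex.exp (-g 0) :=
    is_const_of_deriv_eq_zero (fun w => (hderiv w).differentiableAt) (fun w => (hderiv w).deriv) z 0
  rwa [hg₀, Complex.exp_neg (Complex.log _), Complex.exp_log (hq₀ 0), mul_inv_cancel₀ (hq₀ 0),
    Complex.exp_neg, mul_inv_eq_one₀ (Complex.exp_ne_zero _)] at hconst

theorem exists_polynomial_eq_exp_mul {f h : ℂ → ℂ} (hf : Differentiable ℂ f)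
    (hh : Differentiable ℂ h) (hf₀ : f ≠ 0)
    (horder : ∀ z, analyticOrderAt f z = analyticOrderAt h z) {n : ℕ}
    (hf_growth : characteristic f ⊤ =O[atTop] fun R => R ^ n)
    (hh_growth : characteristic h ⊤ =O[atTop] fun R => R ^ n) :
    ∃ p : Polynomial ℂ, p.natDegree ≤ n ∧ ∀ z, f z = Complex.exp (p.eval z) * h z := by
  have hh₀ : h ≠ 0 := by
    rintro rfl
    exact analyticOrderAt_ne_top_of_ne_zero hf hf₀ 0
      ((horder 0).trans (analyticOrderAt_eq_top.2 (.of_forall fun _ => rfl)))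
  obtain ⟨q, hq, hq₀, hfq⟩ := exists_differentiable_quotient hf hh hh₀ horder
  obtain ⟨g, hg, hqg⟩ := exists_differentiable_log hq hq₀
  have hq_growth := circleAverage_abs_log_norm_isBigO (meromorphic_of_differentiable hq)
    (characteristic_isBigO_of_eq_mul hf hh hf₀ hfq hf_growth hh_growth)
  simp only [hqg, Complex.norm_exp, log_exp] at hq_growth
  obtain ⟨p, hp, hgp⟩ := exists_polynomial_of_circleAverage_abs_re_isBigO hg hq_growth
  exact ⟨p, hp, fun z => by rw [← hgp, ← hqg, hfq, Pi.mul_apply]⟩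

theorem mul_neg_eq_one_of_eq_mul_comp_neg {f e : ℂ → ℂ} (hf : Differentiable ℂ f)
    (he : Differentiable ℂ e) (hf₀ : f ≠ 0) (hfe : ∀ z, f z = e z * f (-z)) (z : ℂ) :
    e z * e (-z) = 1 := by
  obtain ⟨z₀, hz₀⟩ := Function.ne_iff.1 hf₀
  have hnear : (fun w => e w * e (-w)) =ᶠ[𝓝 z₀] fun _ => 1 := by
    filter_upwards [hf.continuous.continuousAt.eventually_ne hz₀] with w hw
    refine mul_right_cancel₀ hw ?_
    conv_rhs => rw [hfe w, hfe (-w), neg_neg]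
    ring
  have han : AnalyticOnNhd ℂ (fun w => e w * e (-w)) Set.univ := fun w _ =>
    (he.mul (he.comp differentiable_neg)).analyticAt w
  exact congrFun (han.eq_of_eventuallyEq analyticOnNhd_const hnear) z

theorem analyticOrderAt_comp_const_mul {f : ℂ → ℂ} {c : ℂ} (hc : c ≠ 0) (z : ℂ) :
    analyticOrderAt (fun w => f (c * w)) z = analyticOrderAt f (c * z) := by
  refine analyticOrderAt_comp_of_deriv_ne_zero (f := f) (g := fun w => c * w) (by fun_prop) ?_
  rw [deriv_const_mul _ differentiableAt_fun_id]
  simpa using hc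

theorem eval_eq_add_mul_of_exp_eval_mul_exp_eval_neg {p : Polynomial ℂ} (hp : p.natDegree ≤ 2)
    (hexp : ∀ z, Complex.exp (p.eval z) * Complex.exp (p.eval (-z)) = 1) (z : ℂ) :
    p.eval z = p.coeff 0 + p.coeff 1 * z := by
  have hp_eval (z : ℂ) : p.eval z = p.coeff 0 + p.coeff 1 * z + p.coeff 2 * z ^ 2 := by
    simp [Polynomial.eval_eq_sum_range' (Nat.lt_succ_of_le hp), Finset.sum_range_succ]
  have hsum (z : ℂ) : Complex.exp (2 * p.coeff 0 + 2 * p.coeff 2 * z ^ 2) = 1 := by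
    rw [← hexp z, ← Complex.exp_add, hp_eval, hp_eval]
    ring_nf
  have hcoeff₂ : p.coeff 2 = 0 := by
    by_contra hne
    obtain ⟨w, hw⟩ := IsAlgClosed.exists_pow_nat_eq (π * Complex.I / (2 * p.coeff 2)) two_pos
    have hcoeff₀ := hsum 0
    have hpi := hsum w
    rw [zero_pow two_ne_zero, mul_zero, add_zero] at hcoeff₀
    rw [hw, mul_div_cancel₀ _ (mul_ne_zero two_ne_zero hne), Complex.exp_add, hcoeff₀,
      Complex.exp_pi_mul_I] at hpi
    norm_num at hpi
  rw [hp_eval, hcoeff₂, zero_mul, add_zero]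

theorem exists_eq_exp_mul_comp_neg {f : ℂ → ℂ} (hf : Differentiable ℂ f) (hf₀ : f 0 ≠ 0) {C B : ℝ}
    (hbound : ∀ z, ‖f z‖ ≤ C * exp (B * ‖z‖ ^ 2))
    (hsymm : ∀ z, analyticOrderAt f (-z) = analyticOrderAt f z) :
    ∃ b : ℂ, ∀ z, f z = Complex.exp (b * z) * f (-z) := by
  have hfne : f ≠ 0 := fun h => hf₀ (congrFun h 0)
  have horder (z : ℂ) : analyticOrderAt f z = analyticOrderAt (fun w => f (-w)) z := by
    rw [← hsymm]
    simpa using (analyticOrderAt_comp_const_mul (f := f) (neg_ne_zero.2 one_ne_zero) z).symm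
  obtain ⟨p, hp, hfp⟩ := exists_polynomial_eq_exp_mul hf (hf.comp differentiable_neg) hfne horder
    (characteristic_top_isBigO_pow hf hbound)
    (characteristic_top_isBigO_pow (hf.comp differentiable_neg)
      fun z => by simpa using hbound (-z))
  have hp_eval := eval_eq_add_mul_of_exp_eval_mul_exp_eval_neg hp
    (mul_neg_eq_one_of_eq_mul_comp_neg hf p.differentiable.cexp hfne hfp)
  have hcoeff₀ : Complex.exp (p.coeff 0) = 1 := by
    simpa [hp_eval, hf₀] using hfp 0
  exact ⟨p.coeff 1, fun z => by
    rw [hfp z, hp_eval, Complex.exp_add, hcoeff₀, one_mul, Function.comp_apply]⟩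

end EntireFunctions

open ProbabilityTheory

/-! ### Random variables with Gaussian tails -/

section GaussianTails

variable {Ω : Type*} {mΩ : MeasurableSpace Ω} {μ : Measure Ω} {X : Ω → ℝ} {r : ℝ}

theorem exp_mul_le_exp_sq (hr : 0 < r) (t x : ℝ) :
    Real.exp (t * x) ≤ Real.exp ((4 * r)⁻¹ * t ^ 2) * Real.exp (r * x ^ 2) := by
  rw [← Real.exp_add, Real.exp_le_exp, ← sub_nonneg]
  have hsquare : (4 * r)⁻¹ * t ^ 2 + r * x ^ 2 - t * x = (t - 2 * r * x) ^ 2 / (4 * r) := by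
    field_simp
    ring
  rw [hsquare]
  positivity

theorem integrable_exp_mul_of_integrable_exp_sq (hX : AEMeasurable X μ) (hr : 0 < r)
    (hint : Integrable (fun ω => Real.exp (r * X ω ^ 2)) μ) (t : ℝ) :
    Integrable (fun ω => Real.exp (t * X ω)) μ := by
  refine (hint.const_mul (Real.exp ((4 * r)⁻¹ * t ^ 2))).mono' (by fun_prop)
    (.of_forall fun ω => ?_)
  rw [Real.norm_of_nonneg (Real.exp_nonneg _)]
  exact exp_mul_le_exp_sq hr t (X ω)

theorem integrableExpSet_eq_univ_of_integrable_exp_sq (hX : AEMeasurable X μ) (hr : 0 < r)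
    (hint : Integrable (fun ω => Real.exp (r * X ω ^ 2)) μ) : integrableExpSet X μ = Set.univ :=
  Set.eq_univ_of_forall (integrable_exp_mul_of_integrable_exp_sq hX hr hint)

theorem mgf_le_of_integrable_exp_sq (hX : AEMeasurable X μ) (hr : 0 < r)
    (hint : Integrable (fun ω => Real.exp (r * X ω ^ 2)) μ) (t : ℝ) :
    mgf X μ t ≤ μ[fun ω => Real.exp (r * X ω ^ 2)] * Real.exp ((4 * r)⁻¹ * t ^ 2) := by
  rw [mul_comm, ← integral_const_mul]
  exact integral_mono (integrable_exp_mul_of_integrable_exp_sq hX hr hint t) (hint.const_mul _)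
    fun ω => exp_mul_le_exp_sq hr t (X ω)

theorem norm_complexMGF_le_of_integrable_exp_sq (hX : AEMeasurable X μ) (hr : 0 < r)
    (hint : Integrable (fun ω => Real.exp (r * X ω ^ 2)) μ) (z : ℂ) :
    ‖complexMGF X μ z‖ ≤
      μ[fun ω => Real.exp (r * X ω ^ 2)] * Real.exp ((4 * r)⁻¹ * ‖z‖ ^ 2) := by
  refine (norm_complexMGF_le_mgf.trans (mgf_le_of_integrable_exp_sq hX hr hint z.re)).trans ?_
  have hre : z.re ^ 2 ≤ ‖z‖ ^ 2 := sq_le_sq.2 (by simpa using Complex.abs_re_le_norm z)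
  gcongr

theorem differentiable_complexMGF (hX : integrableExpSet X μ = Set.univ) :
    Differentiable ℂ (complexMGF X μ) := fun z =>
  (hasDerivAt_complexMGF (by simp [hX])).differentiableAt

theorem complexMGF_sub_const (m : ℝ) (z : ℂ) :
    complexMGF (fun ω => X ω - m) μ z = Complex.exp (-(m * z)) * complexMGF X μ z := by
  simp only [complexMGF, ← integral_const_mul, ← Complex.exp_add]
  congr with ω
  push_cast
  ring_nf

theorem complexMGF_const_sub (m : ℝ) (z : ℂ) :
    complexMGF (fun ω => m - X ω) μ z = Complex.exp (m * z) * complexMGF X μ (-z) := by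
  simp only [complexMGF, ← integral_const_mul, ← Complex.exp_add]
  congr with ω
  push_cast
  ring_nf

theorem eq_two_mul_integral_of_complexMGF_eq [IsProbabilityMeasure μ]
    (hX : 0 ∈ interior (integrableExpSet X μ)) {b : ℂ}
    (hb : ∀ z, complexMGF X μ z = Complex.exp (b * z) * complexMGF X μ (-z)) :
    b = 2 * ((∫ ω, X ω ∂μ : ℝ) : ℂ) := by
  have hderiv : HasDerivAt (complexMGF X μ) ((∫ ω, X ω ∂μ : ℝ) : ℂ) 0 := by
    simpa [integral_complex_ofReal] using hasDerivAt_complexMGF (z := 0) (by simpa using hX)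
  have hderiv_neg : HasDerivAt (fun z => complexMGF X μ (-z)) (-((∫ ω, X ω ∂μ : ℝ) : ℂ)) 0 := by
    have hderiv' : HasDerivAt (complexMGF X μ) ((∫ ω, X ω ∂μ : ℝ) : ℂ) (-0) := by simpa using hderiv
    simpa [Function.comp_def] using hderiv'.comp (0 : ℂ) (hasDerivAt_neg (0 : ℂ))
  have hderiv_exp : HasDerivAt (fun z => Complex.exp (b * z)) b 0 := by
    simpa using ((hasDerivAt_id (0 : ℂ)).const_mul b).cexp
  have heq := hderiv.unique ((hderiv_exp.mul hderiv_neg).congr_of_eventuallyEq (.of_forall hb))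
  simp only [neg_zero, complexMGF, zero_mul, mul_zero, Complex.exp_zero, integral_const,
    probReal_univ, one_smul, mul_one, one_mul] at heq
  linear_combination -heq

theorem identDistrib_sub_integral_neg [IsProbabilityMeasure μ] (hX : AEMeasurable X μ) (hr : 0 < r)
    (hint : Integrable (fun ω => Real.exp (r * X ω ^ 2)) μ)
    (hsymm : ∀ z, analyticOrderAt (complexMGF X μ) (-z) = analyticOrderAt (complexMGF X μ) z) :
    IdentDistrib (fun ω => X ω - μ[X]) (fun ω => μ[X] - X ω) μ μ := by
  have huniv := integrableExpSet_eq_univ_of_integrable_exp_sq hX hr hint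
  obtain ⟨b, hb⟩ := exists_eq_exp_mul_comp_neg (differentiable_complexMGF huniv)
    (by simp [complexMGF]) (norm_complexMGF_le_of_integrable_exp_sq hX hr hint) hsymm
  obtain rfl := eq_two_mul_integral_of_complexMGF_eq (by simp [huniv]) hb
  refine ⟨by fun_prop, by fun_prop, Measure.ext_of_complexMGF_eq (by fun_prop) (by fun_prop) ?_⟩
  ext z
  rw [complexMGF_sub_const, complexMGF_const_sub, hb, ← mul_assoc, ← Complex.exp_add]
  ring_nf

end GaussianTails

/-! ### Symmetric random variables and convex costs -/

theorem measurable_of_convexOn_univ {W : ℝ → ℝ} (hW : ConvexOn ℝ Set.univ W) : Measurable W :=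
  (continuousOn_univ.1 (hW.continuousOn isOpen_univ)).measurable

theorem two_mul_le_add_of_even_convex {E : Type*} [AddCommGroup E] [Module ℝ E] {W : E → ℝ}
    (heven : ∀ x, W (-x) = W x) (hconvex : ConvexOn ℝ Set.univ W) (c x : E) :
    2 * W x ≤ W (c + x) + W (c - x) := by
  have hmid := hconvex.2 (Set.mem_univ (c + x)) (Set.mem_univ (x - c)) one_half_pos.le
    one_half_pos.le (add_halves 1)
  have hcentre : (1 / 2 : ℝ) • (c + x) + (1 / 2 : ℝ) • (x - c) = x := by module
  rw [hcentre, smul_eq_mul, smul_eq_mul, ← neg_sub c x, heven] at hmid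
  linarith

section SymmetricVariable

variable {Ω E : Type*} {mΩ : MeasurableSpace Ω} {μ : Measure Ω} [AddCommGroup E] [Module ℝ E]
  [MeasurableSpace E] [MeasurableAdd E]

theorem lintegral_ofReal_le_of_identDistrib_neg {Y : Ω → E}
    (hY : IdentDistrib Y (fun ω => -Y ω) μ μ) {W : E → ℝ} (hW : Measurable W)
    (heven : ∀ x, W (-x) = W x) (hnonneg : ∀ x, 0 ≤ W x) (hconvex : ConvexOn ℝ Set.univ W) (c : E) :
    ∫⁻ ω, ENNReal.ofReal (W (Y ω)) ∂μ ≤ ∫⁻ ω, ENNReal.ofReal (W (c + Y ω)) ∂μ := by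
  have hcost : Measurable fun x => ENNReal.ofReal (W (c + x)) :=
    (hW.comp (measurable_const_add c)).ennreal_ofReal
  have hcostY : AEMeasurable (fun ω => ENNReal.ofReal (W (c + Y ω))) μ :=
    hcost.comp_aemeasurable hY.aemeasurable_fst
  have hreflect : ∫⁻ ω, ENNReal.ofReal (W (c - Y ω)) ∂μ =
      ∫⁻ ω, ENNReal.ofReal (W (c + Y ω)) ∂μ := by
    simpa [sub_eq_add_neg, Function.comp_def] using (hY.comp hcost).lintegral_eq.symm
  have hmid (ω : Ω) : 2 * ENNReal.ofReal (W (Y ω)) ≤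
      ENNReal.ofReal (W (c + Y ω)) + ENNReal.ofReal (W (c - Y ω)) := by
    rw [← ENNReal.ofReal_add (hnonneg _) (hnonneg _), ← ENNReal.ofReal_ofNat,
      ← ENNReal.ofReal_mul zero_le_two]
    exact ENNReal.ofReal_le_ofReal (two_mul_le_add_of_even_convex heven hconvex c (Y ω))
  have hdouble := lintegral_mono (μ := μ) hmid
  rw [lintegral_const_mul' _ _ ENNReal.ofNat_ne_top,
    lintegral_add_left' hcostY, hreflect, ← two_mul] at hdouble
  exact (ENNReal.mul_le_mul_iff_right two_ne_zero ENNReal.ofNat_ne_top).1 hdouble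

end SymmetricVariable

/-! ### The Bayes risk of a fusion rule -/

theorem lintegral_ofReal_prod_pi {ι : Type*} [Fintype ι] {E : ι → Type*}
    [∀ i, MeasurableSpace (E i)] {μ : (i : ι) → Measure (E i)} [∀ i, SigmaFinite (μ i)]
    {f : (i : ι) → E i → ℝ} (hf : ∀ i, Integrable (f i) (μ i)) (hf₀ : ∀ i x, 0 ≤ f i x) :
    ∫⁻ x, ENNReal.ofReal (∏ i, f i (x i)) ∂Measure.pi μ =
      ∏ i, ∫⁻ x, ENNReal.ofReal (f i x) ∂μ i := by
  rw [← ofReal_integral_eq_lintegral_ofReal (Integrable.fintype_prod_dep hf)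
      (.of_forall fun x => Finset.prod_nonneg fun i _ => hf₀ i (x i)),
    integral_fintype_prod_eq_prod, ENNReal.ofReal_prod_of_nonneg fun i _ => integral_nonneg (hf₀ i)]
  exact Finset.prod_congr rfl fun i _ =>
    ofReal_integral_eq_lintegral_ofReal (hf i) (.of_forall (hf₀ i))

namespace FusionProblem

attribute [instance] prior_prob ref_sigmaFinite

variable {M : ℕ} {N : Fin M → ℕ} {I : Set ℝ}
  {J : (m : Fin M) → Set (EuclideanSpace ℝ (Fin (N m)))} {P : FusionProblem M N I J}

section Likelihood

variable (P)

theorem continuous_likelihood :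
    Continuous fun x : ((m : Fin M) → J m) × I => P.likelihood x.1 x.2 :=
  continuous_finsetProd _ fun m _ => (P.dens_continuous m).comp
    (f := fun x : ((m : Fin M) → J m) × I => (x.1 m, x.2)) (by fun_prop)

theorem continuous_likelihood_right (a : (m : Fin M) → J m) : Continuous (P.likelihood a) :=
  P.continuous_likelihood.comp (f := fun h : I => (a, h)) (by fun_prop)

theorem measurable_ofReal_likelihood :
    Measurable fun x : I × ((m : Fin M) → J m) => ENNReal.ofReal (P.likelihood x.2 x.1) :=
  (P.continuous_likelihood.comp continuous_swap).measurable.ennreal_ofReal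

theorem likelihood_pos (a : (m : Fin M) → J m) (h : I) : 0 < P.likelihood a h :=
  Finset.prod_pos fun m _ => P.dens_pos m (a m) h

theorem exists_likelihood_le : ∃ B : ℝ, ∀ a h, P.likelihood a h ≤ B := by
  choose B hB using P.dens_bounded
  exact ⟨∏ m, B m, fun a h =>
    Finset.prod_le_prod (fun m _ => (P.dens_pos m (a m) h).le) fun m _ => hB m (a m) h⟩

theorem integrable_likelihood_smul {E : Type*} [NormedAddCommGroup E] [NormedSpace ℝ E]
    (a : (m : Fin M) → J m) {φ : I → E} (hφ : Integrable φ P.prior) :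
    Integrable (fun h => P.likelihood a h • φ h) P.prior := by
  obtain ⟨B, hB⟩ := P.exists_likelihood_le
  refine hφ.bdd_smul B (P.continuous_likelihood_right a).aestronglyMeasurable
    (.of_forall fun h => ?_)
  rw [Real.norm_of_nonneg (P.likelihood_pos a h).le]
  exact hB a h

theorem integrable_likelihood (a : (m : Fin M) → J m) : Integrable (P.likelihood a) P.prior := by
  simpa using P.integrable_likelihood_smul a (integrable_const (1 : ℝ))

theorem integrable_dens (m : Fin M) (h : I) : Integrable (fun a => P.dens m a h) (P.ref m) := by
  refine ⟨((P.dens_continuous m).comp (f := fun a : J m => (a, h))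
    (by fun_prop)).aestronglyMeasurable, ?_⟩
  rw [hasFiniteIntegral_iff_ofReal (.of_forall fun a => (P.dens_pos m a h).le),
    P.dens_normalized m h]
  exact ENNReal.one_lt_top

theorem lintegral_likelihood (h : I) :
    ∫⁻ a, ENNReal.ofReal (P.likelihood a h) ∂Measure.pi P.ref = 1 :=
  (lintegral_ofReal_prod_pi (fun m => P.integrable_dens m h)
    fun m a => (P.dens_pos m a h).le).trans (by simp [P.dens_normalized])

end Likelihood

section Posterior

variable (P)

/-- The marginal density of `A` at `a`, that is, the normalising constant of Bayes' formula. -/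
noncomputable def evidence (a : (m : Fin M) → J m) : ℝ := ∫ h, P.likelihood a h ∂P.prior

/-- The conditional law of `H` given `A = a`, on the object space. Bayes' formula is the exponential
tilting of the prior by the log-likelihood, since the likelihood is positive. -/
noncomputable def posterior (a : (m : Fin M) → J m) : Measure I :=
  P.prior.tilted fun h => Real.log (P.likelihood a h)

theorem exp_log_likelihood (a : (m : Fin M) → J m) (h : I) :
    Real.exp (Real.log (P.likelihood a h)) = P.likelihood a h :=
  Real.exp_log (P.likelihood_pos a h)

theorem integrable_exp_log_likelihood (a : (m : Fin M) → J m) :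
    Integrable (fun h => Real.exp (Real.log (P.likelihood a h))) P.prior := by
  simpa only [exp_log_likelihood] using P.integrable_likelihood a

instance isProbabilityMeasure_posterior (a : (m : Fin M) → J m) :
    IsProbabilityMeasure (P.posterior a) :=
  isProbabilityMeasure_tilted (P.integrable_exp_log_likelihood a)

theorem evidence_pos (a : (m : Fin M) → J m) : 0 < P.evidence a := by
  simpa only [exp_log_likelihood, evidence] using
    integral_exp_pos (P.integrable_exp_log_likelihood a)

theorem evidence_mul_lintegral_posterior (a : (m : Fin M) → J m) (F : I → ENNReal) :
    ENNReal.ofReal (P.evidence a) * ∫⁻ h, F h ∂P.posterior a =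
      ∫⁻ h, ENNReal.ofReal (P.likelihood a h) * F h ∂P.prior := by
  rw [posterior, lintegral_tilted, ← lintegral_const_mul' _ _ ENNReal.ofReal_ne_top]
  simp only [exp_log_likelihood, ← mul_assoc, ← ENNReal.ofReal_mul (P.evidence_pos a).le]
  simp only [← evidence.eq_1, mul_div_cancel₀ _ (P.evidence_pos a).ne']

theorem postExp_eq_integral_posterior {E : Type} [NormedAddCommGroup E] [NormedSpace ℝ E]
    (φ : ℝ → E) (a : (m : Fin M) → J m) :
    P.postExp φ a = ∫ h : I, φ h ∂P.posterior a := by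
  rw [posterior, integral_tilted, postExp, ← integral_smul]
  simp only [exp_log_likelihood, smul_smul, div_eq_inv_mul]

theorem integrable_posterior {E : Type*} [NormedAddCommGroup E] [NormedSpace ℝ E]
    (a : (m : Fin M) → J m) {φ : I → E} (hφ : Integrable φ P.prior) :
    Integrable φ (P.posterior a) := by
  rw [posterior, integrable_tilted_iff (P.integrable_exp_log_likelihood a)]
  simpa only [exp_log_likelihood] using P.integrable_likelihood_smul a hφ

theorem posteriorMean_eq_integral (a : (m : Fin M) → J m) :
    P.posteriorMean a = ∫ h : I, (h : ℝ) ∂P.posterior a :=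
  P.postExp_eq_integral_posterior _ a

theorem measurable_posteriorMean : Measurable P.posteriorMean := by
  have hevidence : StronglyMeasurable fun a => ∫ h, P.likelihood a h ∂P.prior :=
    P.continuous_likelihood.stronglyMeasurable.integral_prod_right'
  have hmoment : StronglyMeasurable fun a => ∫ h : I, P.likelihood a h • (h : ℝ) ∂P.prior :=
    StronglyMeasurable.integral_prod_right'
      (f := fun x : ((m : Fin M) → J m) × I => P.likelihood x.1 x.2 • (x.2 : ℝ))
      (P.continuous_likelihood.smul (by fun_prop)).stronglyMeasurable
  exact hevidence.measurable.inv.smul hmoment.measurable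

theorem postChar_eq_complexMGF (a : (m : Fin M) → J m) :
    P.postChar a = fun z =>
      complexMGF Subtype.val (P.posterior a) (-2 * Real.pi * Complex.I * z) :=
  funext fun _ => P.postExp_eq_integral_posterior _ a

end Posterior

theorem SubGaussian.integrable_rpow_abs (hP : P.SubGaussian) {p : ℝ} (hp : 0 ≤ p) :
    Integrable (fun h : I => |(h : ℝ)| ^ p) P.prior := by
  obtain ⟨r, hr, hint⟩ := hP
  refine integrable_rpow_abs_of_mem_interior_integrableExpSet (X := Subtype.val) ?_ hp
  simp [integrableExpSet_eq_univ_of_integrable_exp_sq measurable_subtype_coe.aemeasurable hr hint]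

theorem SubGaussian.integrable_of_abs_le_rpow (hP : P.SubGaussian) {W : ℝ → ℝ} (hW : Measurable W)
    {α p : ℝ} (hp : 0 ≤ p) (hbound : ∀ x, |W x| ≤ α * (|x| ^ p + 1)) :
    Integrable (fun h : I => W h) P.prior :=
  (((hP.integrable_rpow_abs hp).add (integrable_const 1)).const_mul α).mono'
    (hW.comp measurable_subtype_coe).aestronglyMeasurable (.of_forall fun h => hbound h)

theorem SubGaussian.integrable_coe (hP : P.SubGaussian) :
    Integrable (fun h : I => (h : ℝ)) P.prior :=
  hP.integrable_of_abs_le_rpow (α := 1) measurable_id zero_le_one fun x => by simp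

theorem SubGaussian.posteriorMean_mem (hP : P.SubGaussian) {K : Set ℝ} (hK : K.OrdConnected)
    (hIK : I ⊆ K) (a : (m : Fin M) → J m) : P.posteriorMean a ∈ K := by
  have hint := P.integrable_posterior a hP.integrable_coe
  rw [posteriorMean_eq_integral]
  obtain ⟨x, hx⟩ := exists_le_integral hint
  obtain ⟨y, hy⟩ := exists_integral_le hint
  exact hK.out (hIK x.2) (hIK y.2) ⟨hx, hy⟩

theorem SubGaussian.differentiable_complexMGF_posterior (hP : P.SubGaussian)
    (a : (m : Fin M) → J m) : Differentiable ℂ (complexMGF Subtype.val (P.posterior a)) := by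
  obtain ⟨r, hr, hint⟩ := hP
  exact differentiable_complexMGF (integrableExpSet_eq_univ_of_integrable_exp_sq
    measurable_subtype_coe.aemeasurable hr (P.integrable_posterior a hint))

theorem SubGaussian.differentiable_postChar (hP : P.SubGaussian) (a : (m : Fin M) → J m) :
    Differentiable ℂ (P.postChar a) := by
  rw [postChar_eq_complexMGF]
  exact (hP.differentiable_complexMGF_posterior a).comp (by fun_prop)

theorem SymmetricZeros.analyticOrderAt_postChar_neg (hzeros : P.SymmetricZeros)
    {a : (m : Fin M) → J m} (hdiff : Differentiable ℂ (P.postChar a)) (z : ℂ) :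
    analyticOrderAt (P.postChar a) (-z) = analyticOrderAt (P.postChar a) z := by
  by_cases hz : P.postChar a z = 0
  · exact (hzeros a z hz).2
  · have hneg : P.postChar a (-z) ≠ 0 := fun hneg => hz (by simpa using (hzeros a (-z) hneg).1)
    rw [(hdiff.analyticAt z).analyticOrderAt_eq_zero.2 hz,
      (hdiff.analyticAt (-z)).analyticOrderAt_eq_zero.2 hneg]

theorem SymmetricZeros.analyticOrderAt_complexMGF_posterior_neg (hzeros : P.SymmetricZeros)
    (hP : P.SubGaussian) (a : (m : Fin M) → J m) (w : ℂ) :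
    analyticOrderAt (complexMGF Subtype.val (P.posterior a)) (-w) =
      analyticOrderAt (complexMGF Subtype.val (P.posterior a)) w := by
  have hc : -2 * (Real.pi : ℂ) * Complex.I ≠ 0 := by simp [Real.pi_ne_zero]
  have hneg := hzeros.analyticOrderAt_postChar_neg (hP.differentiable_postChar a)
    ((-2 * (Real.pi : ℂ) * Complex.I)⁻¹ * w)
  rwa [postChar_eq_complexMGF, analyticOrderAt_comp_const_mul hc,
    analyticOrderAt_comp_const_mul hc, mul_neg, mul_inv_cancel_left₀ hc] at hneg

theorem SymmetricZeros.identDistrib_sub_posteriorMean (hzeros : P.SymmetricZeros)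
    (hP : P.SubGaussian) (a : (m : Fin M) → J m) :
    IdentDistrib (fun h : I => h - P.posteriorMean a) (fun h : I => P.posteriorMean a - h)
      (P.posterior a) (P.posterior a) := by
  have horder := hzeros.analyticOrderAt_complexMGF_posterior_neg hP a
  obtain ⟨r, hr, hint⟩ := hP
  rw [posteriorMean_eq_integral]
  exact identDistrib_sub_integral_neg measurable_subtype_coe.aemeasurable hr
    (P.integrable_posterior a hint) horder

theorem SymmetricZeros.lintegral_posterior_posteriorMean_le (hzeros : P.SymmetricZeros)
    (hP : P.SubGaussian) {W : ℝ → ℝ} (hW : Measurable W) (heven : ∀ x, W (-x) = W x)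
    (hnonneg : ∀ x, 0 ≤ W x) (hconvex : ConvexOn ℝ Set.univ W) (a : (m : Fin M) → J m) (c : ℝ) :
    ∫⁻ h : I, ENNReal.ofReal (W (P.posteriorMean a - h)) ∂P.posterior a ≤
      ∫⁻ h : I, ENNReal.ofReal (W (c - h)) ∂P.posterior a := by
  have hsymm := (hzeros.identDistrib_sub_posteriorMean hP a).symm
  simpa [sub_add_sub_cancel] using lintegral_ofReal_le_of_identDistrib_neg
    (Y := fun h : I => P.posteriorMean a - h) (by simpa only [neg_sub] using hsymm) hW heven
    hnonneg hconvex (c - P.posteriorMean a)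

section BayesRisk

theorem lintegral_jointLaw {F : I × ((m : Fin M) → J m) → ENNReal} (hF : Measurable F) :
    ∫⁻ x, F x ∂P.jointLaw =
      ∫⁻ x, ENNReal.ofReal (P.likelihood x.2 x.1) * F x ∂P.prior.prod (Measure.pi P.ref) :=
  lintegral_withDensity_eq_lintegral_mul _ P.measurable_ofReal_likelihood hF

theorem lintegral_jointLaw_eq_lintegral_posterior {F : I × ((m : Fin M) → J m) → ENNReal}
    (hF : Measurable F) :
    ∫⁻ x, F x ∂P.jointLaw = ∫⁻ a, ENNReal.ofReal (P.evidence a) *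
      ∫⁻ h, F (h, a) ∂P.posterior a ∂Measure.pi P.ref := by
  have hdensity : Measurable fun x => ENNReal.ofReal (P.likelihood x.2 x.1) * F x :=
    P.measurable_ofReal_likelihood.mul hF
  rw [lintegral_jointLaw hF, lintegral_prod_symm _ hdensity.aemeasurable]
  exact lintegral_congr fun a => (P.evidence_mul_lintegral_posterior a fun h => F (h, a)).symm

theorem fst_jointLaw : P.jointLaw.fst = P.prior := by
  refine Measure.ext_of_lintegral _ fun F hF => ?_
  have hfst : Measurable fun x : I × ((m : Fin M) → J m) => F x.1 := hF.comp measurable_fst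
  have hdensity : Measurable fun x : I × ((m : Fin M) → J m) =>
      ENNReal.ofReal (P.likelihood x.2 x.1) * F x.1 :=
    P.measurable_ofReal_likelihood.mul hfst
  rw [Measure.fst, lintegral_map hF measurable_fst, lintegral_jointLaw hfst,
    lintegral_prod _ hdensity.aemeasurable]
  refine lintegral_congr fun h => ?_
  have hsection : Measurable fun a => ENNReal.ofReal (P.likelihood a h) :=
    P.measurable_ofReal_likelihood.comp measurable_prodMk_left
  dsimp only
  rw [lintegral_mul_const _ hsection, P.lintegral_likelihood, one_mul]

variable {cost : ℝ → ℝ → ℝ}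

theorem bayesRisk_const {c : ℝ} (hcost : Measurable (cost c)) :
    P.bayesRisk cost (fun _ => c) = ∫⁻ h : I, ENNReal.ofReal (cost c h) ∂P.prior := by
  have hcost' : Measurable fun h : I => ENNReal.ofReal (cost c h) :=
    (hcost.comp measurable_subtype_coe).ennreal_ofReal
  rw [← P.fst_jointLaw, Measure.fst, lintegral_map hcost' measurable_fst, bayesRisk]

theorem bayesRisk_le_of_forall_lintegral_posterior_le (hcost : Measurable (Function.uncurry cost))
    {f g : ((m : Fin M) → J m) → ℝ} (hf : Measurable f) (hg : Measurable g)
    (hle : ∀ a, ∫⁻ h : I, ENNReal.ofReal (cost (f a) h) ∂P.posterior a ≤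
      ∫⁻ h : I, ENNReal.ofReal (cost (g a) h) ∂P.posterior a) :
    P.bayesRisk cost f ≤ P.bayesRisk cost g := by
  have hmeas {g : ((m : Fin M) → J m) → ℝ} (hg : Measurable g) :
      Measurable fun x : I × ((m : Fin M) → J m) => ENNReal.ofReal (cost (g x.2) x.1) :=
    (hcost.comp ((hg.comp measurable_snd).prodMk
      (measurable_subtype_coe.comp measurable_fst))).ennreal_ofReal
  rw [bayesRisk, bayesRisk, lintegral_jointLaw_eq_lintegral_posterior (hmeas hf),
    lintegral_jointLaw_eq_lintegral_posterior (hmeas hg)]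
  exact lintegral_mono fun a => mul_le_mul_right (hle a) _

end BayesRisk

end FusionProblem

theorem mainTheorem4_general {M : ℕ} {N : Fin M → ℕ} {I : Set ℝ}
    {J : (m : Fin M) → Set (EuclideanSpace ℝ (Fin (N m)))}
    (P : FusionProblem M N I J)
    (hsub : P.SubGaussian) (hzeros : P.SymmetricZeros)
    (K : Set ℝ) (hK : K.OrdConnected) (hIK : I ⊆ K)
    (W : ℝ → ℝ) (heven : ∀ x, W (-x) = W x)
    (hnonneg : ∀ x, 0 ≤ W x) (hconvex : ConvexOn ℝ Set.univ W)
    (hint : Integrable (fun h : I => W h) P.prior) :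
    P.IsBayesOptimal K (fun c h => W (c - h)) P.posteriorMean := by
  have hW : Measurable W := measurable_of_convexOn_univ hconvex
  have hrisk_le {g : ((m : Fin M) → J m) → ℝ} (hg : Measurable g) :
      P.bayesRisk (fun c h => W (c - h)) P.posteriorMean ≤
        P.bayesRisk (fun c h => W (c - h)) g :=
    FusionProblem.bayesRisk_le_of_forall_lintegral_posterior_le
      (cost := fun c h => W (c - h)) (hW.comp measurable_sub) P.measurable_posteriorMean hg fun a =>
        hzeros.lintegral_posterior_posteriorMean_le hsub hW heven hnonneg hconvex a (g a)
  have hrisk_zero : P.bayesRisk (fun c h => W (c - h)) (fun _ => 0) < ⊤ := by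
    rw [FusionProblem.bayesRisk_const (by fun_prop)]
    simpa only [zero_sub, heven] using hint.lintegral_lt_top
  exact ⟨⟨P.measurable_posteriorMean, hsub.posteriorMean_mem hK hIK⟩,
    (hrisk_le measurable_const).trans_lt hrisk_zero, fun g hg => hrisk_le hg.1⟩

theorem mainTheorem4 {M : ℕ} {N : Fin M → ℕ} {I : Set ℝ}
    {J : (m : Fin M) → Set (EuclideanSpace ℝ (Fin (N m)))}
    (P : FusionProblem M N I J)
    (hsub : P.SubGaussian) (hzeros : P.SymmetricZeros)
    (K : Set ℝ) (hK : K.OrdConnected) (hIK : I ⊆ K)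
    (W : ℝ → ℝ) (hentire : IsEntireOnReal W) (heven : ∀ x, W (-x) = W x)
    (hnonneg : ∀ x, 0 ≤ W x) (hconvex : ConvexOn ℝ Set.univ W)
    (hgrowth : ∃ α₁ α₂ p : ℝ, 0 < α₁ ∧ 0 < α₂ ∧ 1 ≤ p ∧
      ∀ x : ℝ, α₁ * (|x| ^ p - 1) ≤ |W x| ∧ |W x| ≤ α₂ * (|x| ^ p + 1)) :
    P.IsBayesOptimal K (fun c h => W (c - h)) P.posteriorMean := by
  obtain ⟨_, _, p, -, -, hp, hgrowth⟩ := hgrowth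
  exact mainTheorem4_general P hsub hzeros K hK hIK W heven hnonneg hconvex
    (hsub.integrable_of_abs_le_rpow (measurable_of_convexOn_univ hconvex) (zero_le_one.trans hp)
      fun x => (hgrowth x).2)
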